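/- **Theorem 1.** Let $G=(V,E)$ be a finite directed acyclic graph, and let $s,d\in V$ be a source and a terminal, where $d$ has no outgoing edges and $d$ is reachable from $s$ by a directed path. For $v\in V$ write $\text{In-edges}(v)=\{(w,v)\in E\}$ and $\text{In-nodes}(v)=\{w:(w,v)\in E\}$. *Secure multicast.* Every node $v\in V$ generates an infinite sequence of bits $b_v=(b_{v,j})_{j\in\mathbb N}$; all bits are uniform and mutually independent. A network code assigns to each edge $e=(v,w)$ a finite alphabet $\mathcal X_e$ and a (measurable) encoding function $f_e$; the message $X_e\in\mathcal X_e$ on $e$ is the value of $f_e$ on $\big((X_{e'})_{e'\in\text{In-edges}(v)},\,b_v\big)$. A rate $R$ is achievable if there are a network code and a finite set $K$ of the bits generated at $s$ such that - (message rate) $K$ takes $\lceil 2^{R}\rceil$ values, all equally likely; - (decoding) some decoding function recovers $K$ almost surely from $(X_e)_{e\in\text{In-edges}(d)}$ and $b_d$; - (secrecy) $I\big(K;(X_e)_{e\in\text{In-edges}(v)}\big)=0$ for every $v\in V\setminus\{s,d\}$. *Protected cut vertices.* A vertex $u\in V\setminus\{s,d\}$ is a cut vertex separating $s$ from $d$ if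 every directed path from $s$ to $d$ passes through $u$. An alternating path from $s$ to $d$ is a path from $s$ to $d$ in the undirected graph underlying $G$, where vertices and edges may be repeated; a vertex $v$ is a collider of it if two consecutive edges of the path both enter $v$ in $G$. A cut vertex $u$ is protected if some alternating path from $s$ to $d$ does not contain $u$ and has all its colliders in $\text{In-nodes}(u)$. Then some rate $R>0$ is achievable if and only if every cut vertex separating $s$ from $d$ is protected. -/

import Mathlib

open MeasureTheory

/-- A directed graph without directed cycles; an edge `(u, v)` is a pair with `Adj u v`. -/
structure AcyclicNetwork (V : Type*) extends Digraph V where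
  acyclic : ∀ v : V, ¬ Relation.TransGen Adj v v

namespace AcyclicNetwork

variable {V : Type*} (G : AcyclicNetwork V)

/-- The edges of the network. -/
def Edge : Type _ := {e : V × V // G.Adj e.1 e.2}

/-- The edges entering the vertex `v`. -/
def InEdges (v : V) : Type _ := {e : G.Edge // e.1.2 = v}

/-- `v` is an in-node of `u`: there is an edge from `v` to `u`. -/
def InNodes (u : V) : Set V := {v | G.Adj v u}

/-- `e'` immediately precedes `e`: the head of `e'` is the tail of `e`. -/
def EdgePrec (e' e : G.Edge) : Prop := e'.1.2 = e.1.1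

theorem wellFounded_edgePrec [Finite V] : WellFounded G.EdgePrec := by
  have : IsTrans V (Relation.TransGen G.Adj) := ⟨fun _ _ _ h h' => h.trans h'⟩
  have : Std.Irrefl (Relation.TransGen G.Adj) := ⟨G.acyclic⟩
  have hwf : WellFounded (Relation.TransGen G.Adj) := Finite.wellFounded_of_trans_of_irrefl _
  refine Subrelation.wf ?_ (InvImage.wf (fun e : G.Edge => e.1.1) hwf)
  intro e' e h
  have h' : G.Adj e'.1.1 e'.1.2 := e'.2
  rw [show e'.1.2 = e.1.1 from h] at h'
  exact Relation.TransGen.single h'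

/-! ### Cut vertices and alternating paths -/

/-- There is a directed (possibly empty) path from `a` to `b`. -/
def Reaches (a b : V) : Prop := Relation.ReflTransGen G.Adj a b

/-- `u`, different from `s` and `d`, is a cut vertex for `(s, d)`: removing `u` leaves no directed
path from `s` to `d`. -/
def IsCutVertex (s d u : V) : Prop :=
  u ≠ s ∧ u ≠ d ∧ ¬ Relation.ReflTransGen (fun a b => G.Adj a b ∧ a ≠ u ∧ b ≠ u) s d

/-- An alternating path from `a` to `b`: a path in the undirected variant of the network.
Its directed pieces need not be disjoint, so vertices and edges may be repeated. -/
abbrev AltPath (a b : V) : Type _ := G.toDigraph.toSimpleGraphInclusive.Walk a b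

/-- `v` is a collider of the alternating path `p`: two consecutive edges of `p` enter `v`. -/
def IsCollider {a b : V} (p : G.AltPath a b) (v : V) : Prop :=
  ∃ x y : V, [x, v, y] <:+: p.support ∧ G.Adj x v ∧ G.Adj y v

/-- `u` is protected with respect to `(s, d)`: some alternating path from `s` to `d` avoids `u` and
has all its colliders among the in-nodes of `u`. -/
def IsProtected (s d u : V) : Prop :=
  ∃ p : G.AltPath s d, u ∉ p.support ∧ ∀ v, G.IsCollider p v → v ∈ G.InNodes u

/-! ### Random bits and network codes -/

/-- The outcomes of all random bits: `ω v j` is the `j`-th bit generated at the vertex `v`. -/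
abbrev Bits (V : Type*) : Type _ := V → ℕ → Bool

/-- The law of the random bits: all of them are independent and uniform. -/
noncomputable def bitsLaw (V : Type*) : Measure (Bits V) :=
  Measure.infinitePi fun _ : V =>
    Measure.infinitePi fun _ : ℕ => (PMF.uniformOfFintype Bool).toMeasure

/-- The encoding part of a network code: every edge has a finite alphabet and a local encoding
function, whose inputs are the messages on the edges entering the tail of the edge and the bits
generated at that tail. (As alphabets are finite, measurability in the bits for each fixed value of
the incoming messages is joint measurability.) -/
structure NetworkCode where
  alphabet : G.Edge → Type
  finite_alphabet : ∀ e, Finite (alphabet e)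
  encode : ∀ e : G.Edge, (∀ e' : G.InEdges e.1.1, alphabet e'.1) → (ℕ → Bool) → alphabet e
  measurable_encode : ∀ (e : G.Edge) (x : ∀ e' : G.InEdges e.1.1, alphabet e'.1) (a : alphabet e),
    MeasurableSet {b : ℕ → Bool | encode e x b = a}

namespace NetworkCode

variable {G} (c : G.NetworkCode)

/-- The alphabets carry the discrete `σ`-algebra. -/
instance (e : G.Edge) : MeasurableSpace (c.alphabet e) := ⊤

variable [Finite V]

/-- The message `X_e` carried by the edge `e`, obtained by evaluating the encoding functions along
the acyclic network. -/
noncomputable def message (ω : Bits V) : ∀ e : G.Edge, c.alphabet e :=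
  G.wellFounded_edgePrec.fix fun e X => c.encode e (fun e' => X e'.1 e'.2) (ω e.1.1)

/-- The messages on all edges entering `v`. -/
noncomputable def inMessages (v : V) (ω : Bits V) : ∀ e : G.InEdges v, c.alphabet e.1 :=
  fun e => c.message ω e.1

theorem message_eq (ω : Bits V) (e : G.Edge) :
    c.message ω e = c.encode e (c.inMessages e.1.1 ω) (ω e.1.1) :=
  G.wellFounded_edgePrec.fix_eq _ e

end NetworkCode

/-- The message `K` consisting of the bits with indices in `J` generated at the source `s`. -/
def sourceMessage (s : V) (J : Finset ℕ) (ω : Bits V) : J → Bool := fun j => ω s j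

/-- The mutual information `I(X; Y)`: the relative entropy of the joint law of `X` and `Y` with
respect to the product of their laws. -/
noncomputable def mutualInfo {Ω α β : Type*} [MeasurableSpace Ω] [MeasurableSpace α]
    [MeasurableSpace β] (μ : Measure Ω) (X : Ω → α) (Y : Ω → β) : ENNReal :=
  InformationTheory.klDiv (μ.map fun ω => (X ω, Y ω)) ((μ.map X).prod (μ.map Y))

/-- The rate `R` is achievable for secure multicast from `s` to `d`, where every vertex generates
random bits and no single vertex other than `s` and `d` may learn anything about the message.
There are a network code and a set `J` of bits of `s`, forming the message `K`, such that `K` takes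
`⌈2 ^ R⌉` values (all equally likely), some decoding function recovers `K` almost surely from the
messages entering `d` and the bits generated at `d`, and `K` has zero mutual information with the
messages entering any vertex other than `s` and `d`. -/
def HasSecureMulticastRate [Finite V] (s d : V) (R : ℝ) : Prop :=
  ∃ (c : G.NetworkCode) (J : Finset ℕ),
    2 ^ J.card = ⌈(2 : ℝ) ^ R⌉₊ ∧
    (∃ decode : (∀ e : G.InEdges d, c.alphabet e.1) → (ℕ → Bool) → (J → Bool),
      (∀ x, Measurable (decode x)) ∧
      ∀ᵐ ω ∂(bitsLaw V), decode (c.inMessages d ω) (ω d) = sourceMessage s J ω) ∧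
    ∀ v : V, v ≠ s → v ≠ d → mutualInfo (bitsLaw V) (sourceMessage s J) (c.inMessages v) = 0

end AcyclicNetwork

/-!
# Positive secure-multicast rates

**Necessity** (`AcyclicNetwork.isProtected_of_hasSecureMulticastRate`). Suppose that `u` is not
protected. Let `A` be the set of vertices joined to `s` by an alternating path which avoids `u` and
has its colliders among the in-nodes of `u`; thus `d ∉ A`. Let `T ⊆ A` (`AcyclicNetwork.tied`)
consist of those vertices of `A` at which such a path can be prolonged by an edge into the vertex.
A message entering `u` depends only on the bits of `T` if it comes from `A`, and only on the bits of
the complement of `A` otherwise; what `d` receives depends only on what `u` receives and on the bits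
of the complement of `A`. So take two independent outcomes with the same messages into `u`, and with
different values of the secret; such pairs have positive probability, because the secret is
independent of the messages into `u`. The outcome equal to the first one on `T` and to the second
one elsewhere (`AcyclicNetwork.mixBits`, a measure-preserving operation) has the secret of the first
one, but `d` decodes the secret of the second one from it. This is the global Markov property for
d-separation in the form needed here, with no conditional independence.

**Sufficiency** (`AcyclicNetwork.exists_rate_of_isProtected`). One bit of `s` is encrypted with one
key for each vertex `u ≠ s, d`, and the ciphertext is made public, so it is enough that `d` learns
the key for `u` and that `u` learns nothing about it; there is no harm in other vertices learning
this key. For a given `u`, every vertex generates a key bit and sends it along all paths avoiding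
`u`. An in-node of `u` which knows two of these bits sends their sum to `u`, which forwards it
everywhere. If `u` is protected, then walking along the alternating path shows that some key bit
known at `s` is joined to some key bit known at `d` by a chain of such sums
(`AcyclicNetwork.exists_linked_keys`); and if `u` is not a cut vertex, then a directed path from
`s` to `d` avoids it. Secrecy holds because flipping the secret together with all key bits for `u`
preserves the law of the random bits and everything that `u` sees
(`AcyclicNetwork.sharingMessage_flipBits`). The encoding functions are not written down: a message
which is determined by the incoming messages and finitely many local bits is a measurable function
of them (`AcyclicNetwork.exists_networkCode`).
-/

namespace AcyclicNetwork

/-! ### The law of the random bits -/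

instance {V : Type*} : IsProbabilityMeasure (bitsLaw V) := by
  unfold bitsLaw
  infer_instance

/-- The outcome obtained from `ω` by flipping the bits at the places where `F` is `true`. -/
def flipBits {V : Type*} (F : V → ℕ → Bool) (ω : Bits V) : Bits V :=
  fun v j => xor (F v j) (ω v j)

theorem measurePreserving_flipBits {V : Type*} (F : V → ℕ → Bool) :
    MeasurePreserving (flipBits F) (bitsLaw V) (bitsLaw V) := by
  have hbit (b : Bool) : (PMF.uniformOfFintype Bool).toMeasure.map (xor b) =
      (PMF.uniformOfFintype Bool).toMeasure := by
    rw [PMF.toMeasure_map _ _ (measurable_of_finite _)]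
    congr 1
    ext x
    have h (y : Bool) : (x = xor b y) ↔ y = xor b x := by revert x y b; decide
    simp [PMF.map_apply, h]
  refine ⟨?_, ?_⟩
  · refine measurable_pi_lambda _ fun v => measurable_pi_lambda _ fun j => ?_
    exact (measurable_of_finite (xor (F v j))).comp (by fun_prop)
  · unfold bitsLaw
    have h (v : V) : Measurable fun (x : ℕ → Bool) j => xor (F v j) (x j) :=
      measurable_pi_lambda _ fun j =>
        (measurable_of_finite (xor (F v j))).comp (by fun_prop)
    have h1 := Measure.infinitePi_map_pi (μ := fun _ : V =>
      Measure.infinitePi fun _ : ℕ => (PMF.uniformOfFintype Bool).toMeasure) h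
    refine h1.trans ?_
    congr 1
    funext v
    have h2 := Measure.infinitePi_map_pi
      (μ := fun _ : ℕ => (PMF.uniformOfFintype Bool).toMeasure)
      (f := fun j => xor (F v j)) (fun j => measurable_of_finite _)
    refine h2.trans ?_
    congr 1
    funext j
    exact hbit _

open Classical in
/-- The outcome which agrees with the first of two outcomes at the vertices in `T`, and with the
second one elsewhere. -/
noncomputable def mixBits {V : Type*} (T : Set V) (p : Bits V × Bits V) : Bits V :=
  fun v => if v ∈ T then p.1 v else p.2 v

theorem measurePreserving_mixBits {V : Type*} (T : Set V) :
    MeasurePreserving (mixBits T) ((bitsLaw V).prod (bitsLaw V)) (bitsLaw V) := by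
  classical
  have hm : Measurable (mixBits T) := by
    refine measurable_pi_lambda _ fun v => ?_
    by_cases hv : v ∈ T
    · simp only [mixBits, hv, if_true]; fun_prop
    · simp only [mixBits, hv, if_false]; fun_prop
  refine ⟨hm, ?_⟩
  refine Measure.eq_infinitePi _ fun I t ht => ?_
  rw [Measure.map_apply hm (.pi I.countable_toSet fun _ _ => ht _)]
  have h : mixBits T ⁻¹' ((I : Set V).pi t) =
      (((I.filter (· ∈ T) : Finset V) : Set V).pi t) ×ˢ
        (((I.filter (· ∉ T) : Finset V) : Set V).pi t) := by
    ext p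
    simp only [Set.mem_preimage, Set.mem_pi, Finset.mem_coe, Set.mem_prod, Finset.mem_filter,
      mixBits]
    constructor
    · intro h
      refine ⟨fun v hv => ?_, fun v hv => ?_⟩
      · simpa [hv.2] using h v hv.1
      · simpa [hv.2] using h v hv.1
    · rintro ⟨h1, h2⟩ v hv
      by_cases hT : v ∈ T
      · simpa [hT] using h1 v ⟨hv, hT⟩
      · simpa [hT] using h2 v ⟨hv, hT⟩
  rw [h, Measure.prod_prod, bitsLaw, Measure.infinitePi_pi _ (fun v _ => ht v),
    Measure.infinitePi_pi _ (fun v _ => ht v), Finset.prod_filter_mul_prod_filter_not]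

theorem mutualInfo_eq_zero_iff_indepFun {Ω α β : Type*} [MeasurableSpace Ω] [MeasurableSpace α]
    [MeasurableSpace β] {μ : Measure Ω} [IsProbabilityMeasure μ] {X : Ω → α} {Y : Ω → β}
    (hX : Measurable X) (hY : Measurable Y) :
    mutualInfo μ X Y = 0 ↔ ProbabilityTheory.IndepFun X Y μ := by
  have := Measure.isProbabilityMeasure_map (μ := μ) hX.aemeasurable
  have := Measure.isProbabilityMeasure_map (μ := μ) hY.aemeasurable
  have := Measure.isProbabilityMeasure_map (μ := μ) (hX.prodMk hY).aemeasurable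
  rw [mutualInfo, InformationTheory.klDiv_eq_zero_iff,
    ProbabilityTheory.indepFun_iff_map_prod_eq_prod_map_map hX.aemeasurable hY.aemeasurable]

theorem measurable_sourceMessage {V : Type*} (s : V) (J : Finset ℕ) :
    Measurable (sourceMessage s J) := by
  unfold sourceMessage
  fun_prop

/-- A bit is independent of every observation which does not change when this bit is flipped,
possibly together with other bits. -/
theorem indepFun_of_flipBits {V β : Type*} [MeasurableSpace β] {s : V} {j : ℕ} {Y : Bits V → β}
    (hY : Measurable Y) {F : V → ℕ → Bool} (hF : F s j = true)
    (hinv : ∀ ω, Y (flipBits F ω) = Y ω) :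
    ProbabilityTheory.IndepFun (fun ω : Bits V => ω s j) Y (bitsLaw V) := by
  have hK : Measurable fun ω : Bits V => ω s j := by fun_prop
  have hset (k : Bool) (B : Set β) (hB : MeasurableSet B) :
      MeasurableSet ((fun ω : Bits V => ω s j) ⁻¹' {k} ∩ Y ⁻¹' B) :=
    (hK (measurableSet_singleton _)).inter (hY hB)
  have hswap (B : Set β) (hB : MeasurableSet B) :
      bitsLaw V ((fun ω : Bits V => ω s j) ⁻¹' {true} ∩ Y ⁻¹' B) =
        bitsLaw V ((fun ω : Bits V => ω s j) ⁻¹' {false} ∩ Y ⁻¹' B) := by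
    rw [← (measurePreserving_flipBits F).measure_preimage (hset true B hB).nullMeasurableSet]
    congr 1
    ext ω
    simp [hinv, flipBits, hF]
  have hsum (B : Set β) (hB : MeasurableSet B) :
      bitsLaw V ((fun ω : Bits V => ω s j) ⁻¹' {true} ∩ Y ⁻¹' B) +
        bitsLaw V ((fun ω : Bits V => ω s j) ⁻¹' {false} ∩ Y ⁻¹' B) = bitsLaw V (Y ⁻¹' B) := by
    rw [← measure_union _ (hset _ B hB)]
    · congr 1
      ext ω
      simp only [Set.mem_union, Set.mem_inter_iff, Set.mem_preimage, Set.mem_singleton_iff]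
      cases ω s j <;> simp
    · refine Set.disjoint_left.2 fun ω h h' => ?_
      simp_all
  have hhalf (k : Bool) (B : Set β) (hB : MeasurableSet B) :
      bitsLaw V ((fun ω : Bits V => ω s j) ⁻¹' {k} ∩ Y ⁻¹' B) = bitsLaw V (Y ⁻¹' B) / 2 := by
    rw [ENNReal.eq_div_iff (by simp) (by simp), two_mul, ← hsum B hB]
    cases k <;> rw [hswap B hB]
  rw [ProbabilityTheory.indepFun_iff_measure_inter_preimage_eq_mul]
  intro A B _ hB
  have huniv (k : Bool) : bitsLaw V ((fun ω : Bits V => ω s j) ⁻¹' {k}) = 1 / 2 := by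
    simpa using hhalf k Set.univ MeasurableSet.univ
  have hA : A = ∅ ∨ A = {true} ∨ A = {false} ∨ A = Set.univ := by
    by_cases h1 : true ∈ A <;> by_cases h2 : false ∈ A
    · exact Or.inr (Or.inr (Or.inr (by ext x; cases x <;> simp [h1, h2])))
    · exact Or.inr (Or.inl (by ext x; cases x <;> simp [h1, h2]))
    · exact Or.inr (Or.inr (Or.inl (by ext x; cases x <;> simp [h1, h2])))
    · exact Or.inl (by ext x; cases x <;> simp [h1, h2])
  rcases hA with rfl | rfl | rfl | rfl
  · simp
  · rw [hhalf _ B hB, huniv, ENNReal.div_eq_inv_mul, one_div]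
  · rw [hhalf _ B hB, huniv, ENNReal.div_eq_inv_mul, one_div]
  · rw [Set.preimage_univ, Set.univ_inter, measure_univ, one_mul]

/-- All values of the source message are attained with positive probability: flipping bits of the
source permutes them transitively. -/
theorem measure_sourceMessage_pos {V : Type*} (s : V) (J : Finset ℕ) (k : J → Bool) :
    0 < bitsLaw V (sourceMessage s J ⁻¹' {k}) := by
  classical
  by_contra! h0
  have h0 : bitsLaw V (sourceMessage s J ⁻¹' {k}) = 0 := le_antisymm h0 zero_le
  have hall (k' : J → Bool) : bitsLaw V (sourceMessage s J ⁻¹' {k'}) = 0 := by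
    let F : V → ℕ → Bool := fun _ j => if h : j ∈ J then xor (k ⟨j, h⟩) (k' ⟨j, h⟩) else false
    rw [← h0, ← (measurePreserving_flipBits F).measure_preimage
      (measurable_sourceMessage s J (measurableSet_singleton k)).nullMeasurableSet]
    congr 1
    ext ω
    simp only [Set.mem_preimage, Set.mem_singleton_iff, funext_iff, sourceMessage, flipBits, F]
    refine forall_congr' fun j => ?_
    simp only [j.2, dif_pos]
    generalize k j = a, k' j = b, ω s j = c
    cases a <;> cases b <;> cases c <;> decide
  have h1 : bitsLaw V Set.univ = 0 := by
    have : (Set.univ : Set (Bits V)) = ⋃ k', sourceMessage s J ⁻¹' {k'} := by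
      ext; simp
    rw [this]
    exact measure_iUnion_null hall
  simp at h1

namespace NetworkCode

variable {V : Type*} [Finite V] {G : AcyclicNetwork V} (c : G.NetworkCode)

instance (e : G.Edge) : Finite (c.alphabet e) := c.finite_alphabet e

instance (e : G.Edge) : MeasurableSingletonClass (c.alphabet e) := ⟨fun _ => trivial⟩

instance : Finite G.Edge := inferInstanceAs (Finite {e : V × V // G.Adj e.1 e.2})

instance (v : V) : Finite (G.InEdges v) := inferInstanceAs (Finite {e : G.Edge // e.1.2 = v})

theorem measurable_message (e : G.Edge) : Measurable fun ω => c.message ω e := by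
  induction e using G.wellFounded_edgePrec.induction with
  | _ e ih =>
  have hin : Measurable (c.inMessages e.1.1) :=
    measurable_pi_lambda _ fun e' => ih e'.1 e'.2
  refine measurable_to_countable' fun a => ?_
  have : (fun ω => c.message ω e) ⁻¹' {a} = ⋃ x : ∀ e' : G.InEdges e.1.1, c.alphabet e'.1,
      c.inMessages e.1.1 ⁻¹' {x} ∩ (fun ω : Bits V => ω e.1.1) ⁻¹' {b | c.encode e x b = a} := by
    ext ω
    simp [c.message_eq ω e]
  rw [this]
  refine MeasurableSet.iUnion fun x => (hin (measurableSet_singleton x)).inter ?_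
  exact (measurable_pi_apply e.1.1) (c.measurable_encode e x a)

theorem measurable_inMessages (v : V) : Measurable (c.inMessages v) :=
  measurable_pi_lambda _ fun e => c.measurable_message e.1

end NetworkCode

/-! ### Codes from locally determined messages -/

/-- If `h` is determined by the observation `Y` and the first `N` bits of the vertex `a`, then it
can be computed from `Y` and the bits of `a`, measurably in the bits. -/
theorem exists_measurable_factor {V A B : Type*} [Nonempty A] (a : V) (N : ℕ) (h : Bits V → A)
    (Y : Bits V → B)
    (hdet : ∀ ω ω', Y ω = Y ω' → (∀ j < N, ω a j = ω' a j) → h ω = h ω') :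
    ∃ φ : B → (ℕ → Bool) → A, (∀ ω, φ (Y ω) (ω a) = h ω) ∧
      ∀ y (S : Set A), MeasurableSet {b | φ y b ∈ S} := by
  let r : (ℕ → Bool) → Fin N → Bool := fun b j => b j
  let g : Bits V → B × (Fin N → Bool) := fun ω => (Y ω, r (ω a))
  have hg : h.FactorsThrough g := fun ω ω' hω => by
    obtain ⟨h1, h2⟩ := Prod.ext_iff.1 hω
    exact hdet ω ω' h1 fun j hj => congrFun h2 ⟨j, hj⟩
  refine ⟨fun y b => Function.extend g h (fun _ => Classical.arbitrary A) (y, r b),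
    fun ω => hg.extend_apply _ ω, fun y S => ?_⟩
  have hr : Measurable r := by fun_prop
  exact hr (Set.toFinite {x | Function.extend g h (fun _ => Classical.arbitrary A) (y, x) ∈ S}
    |>.measurableSet)

/-- A family of functions of the random bits, indexed by the edges, is carried by some network code
as soon as the function at each edge is determined by those at the preceding edges and finitely
many bits of the tail. -/
theorem exists_networkCode {V A : Type*} [Finite V] [Finite A] [Nonempty A]
    (G : AcyclicNetwork V) (N : ℕ) (X : G.Edge → Bits V → A)
    (hX : ∀ (e : G.Edge) (ω ω' : Bits V),
      (∀ e' : G.Edge, e'.1.2 = e.1.1 → X e' ω = X e' ω') →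
      (∀ j < N, ω e.1.1 j = ω' e.1.1 j) → X e ω = X e ω') :
    ∃ c : G.NetworkCode, ∀ e ω ω', c.message ω e = c.message ω' e ↔ X e ω = X e ω' := by
  -- Alphabets live in `Type`, so `A` is replaced by some `Fin n`.
  obtain ⟨n, ⟨φ⟩⟩ := Finite.exists_equiv_fin A
  have : Nonempty (Fin n) := φ.symm.nonempty
  have hfac (e : G.Edge) := exists_measurable_factor e.1.1 N (fun ω => φ (X e ω))
    (fun ω (e' : G.InEdges e.1.1) => φ (X e'.1 ω)) (fun ω ω' h h' => congrArg φ <|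
      hX e ω ω' (fun e' he' => φ.injective (congrFun h ⟨e', he'⟩)) h')
  choose enc henc hmeas using hfac
  let c : G.NetworkCode :=
    { alphabet := fun _ => Fin n
      finite_alphabet := fun _ => inferInstance
      encode := enc
      measurable_encode := fun e x a => hmeas e x {a} }
  have hmsg (ω : Bits V) (e : G.Edge) : c.message ω e = φ (X e ω) := by
    induction e using G.wellFounded_edgePrec.induction with
    | _ e ih =>
    rw [c.message_eq, ← henc e ω]
    have : c.inMessages e.1.1 ω = fun e' : G.InEdges e.1.1 => φ (X e'.1 ω) :=
      funext fun e' => ih e'.1 e'.2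
    rw [this]
  exact ⟨c, fun e ω ω' => by rw [hmsg, hmsg]; exact φ.injective.eq_iff⟩

/-! ### Linking keys along an alternating path -/

section Linking

variable {V : Type*} (G : AcyclicNetwork V)

/-- There is a directed path from `a` to `b` which avoids `u`. (The empty path from `u` to `u` is
admitted, as in `Relation.ReflTransGen`.) -/
def AvoidReaches (u a b : V) : Prop :=
  Relation.ReflTransGen (fun x y => G.Adj x y ∧ x ≠ u ∧ y ≠ u) a b

/-- Some in-node of `u` is reached from both `v` and `v'` by directed paths avoiding `u`: it can
tell `u` the sum of two keys generated at `v` and at `v'`. -/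
def Linked (u v v' : V) : Prop :=
  ∃ w ∈ G.InNodes u, G.AvoidReaches u v w ∧ G.AvoidReaches u v' w

variable {G}

theorem not_adj_symm {a b : V} (h : G.Adj a b) : ¬ G.Adj b a := fun h' =>
  G.acyclic a ((Relation.TransGen.single h).tail h')

theorem altAdj_iff {a b : V} :
    G.toDigraph.toSimpleGraphInclusive.Adj a b ↔ G.Adj a b ∨ G.Adj b a := by
  constructor
  · exact fun h => h.2
  · refine fun h => ⟨?_, h⟩
    rintro rfl
    rcases h with h | h <;> exact G.acyclic a (Relation.TransGen.single h)

theorem support_eq_cons {a b : V} (p : G.AltPath a b) : ∃ l, p.support = a :: l := by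
  cases p with
  | nil => exact ⟨_, rfl⟩
  | cons h q => exact ⟨_, rfl⟩

theorem isCollider_cons {a b c v : V} (h : G.toDigraph.toSimpleGraphInclusive.Adj a b)
    (p : G.AltPath b c) :
    G.IsCollider (SimpleGraph.Walk.cons h p) v ↔ G.IsCollider p v ∨
      v = b ∧ G.Adj a b ∧ ∃ y, [b, y] <+: p.support ∧ G.Adj y b := by
  obtain ⟨l, hl⟩ := support_eq_cons p
  simp only [IsCollider, SimpleGraph.Walk.support_cons, List.infix_cons_iff, hl,
    List.cons_prefix_cons, true_and]
  constructor
  · rintro ⟨x, y, ⟨rfl, rfl, h1⟩ | h1, h2, h3⟩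
    · exact Or.inr ⟨rfl, h2, y, h1, h3⟩
    · exact Or.inl ⟨x, y, h1, h2, h3⟩
  · rintro (⟨x, y, h1, h2, h3⟩ | ⟨rfl, h2, y, h1, h3⟩)
    · exact ⟨x, y, Or.inr h1, h2, h3⟩
    · exact ⟨a, y, Or.inl ⟨rfl, rfl, h1⟩, h2, h3⟩

/-- The keys known at the beginning of an alternating path which protects `u` are linked to keys
known at its end. If the path begins with an edge traversed backwards, this holds for some key
known at the beginning; otherwise it holds for each of them, since all of them can be sent along
the first edge. -/
theorem exists_linked_of_altPath {u a d : V} (p : G.AltPath a d) (hu : u ∉ p.support)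
    (hcol : ∀ v, G.IsCollider p v → v ∈ G.InNodes u) :
    (∀ t, G.AvoidReaches u t a →
      ∃ t', G.AvoidReaches u t' d ∧ Relation.ReflTransGen (G.Linked u) t t') ∨
    ((∃ y, [a, y] <+: p.support ∧ G.Adj y a) ∧ ∃ t t', G.AvoidReaches u t a ∧
      G.AvoidReaches u t' d ∧ Relation.ReflTransGen (G.Linked u) t t') := by
  induction p with
  | nil => exact Or.inl fun t ht => ⟨t, ht, .refl⟩
  | @cons a b d h q ih =>
    simp only [SimpleGraph.Walk.support_cons, List.mem_cons, not_or] at hu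
    have hb : b ≠ u := fun hb => hu.2 (hb ▸ q.start_mem_support)
    specialize ih hu.2 fun v hv => hcol v ((isCollider_cons h q).2 (Or.inl hv))
    rcases altAdj_iff.1 h with hab | hba
    · left
      intro t ht
      have htb : G.AvoidReaches u t b := ht.tail ⟨hab, Ne.symm hu.1, hb⟩
      rcases ih with ih | ⟨hy, t0, t', ht0, ht', hlink⟩
      · exact ih t htb
      · have hbu : b ∈ G.InNodes u := hcol b ((isCollider_cons h q).2 (Or.inr ⟨rfl, hab, hy⟩))
        exact ⟨t', ht', hlink.head ⟨b, hbu, htb, ht0⟩⟩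
    · right
      refine ⟨⟨b, ?_, hba⟩, ?_⟩
      · obtain ⟨l, hl⟩ := support_eq_cons q
        simp [hl, List.cons_prefix_cons]
      · have hstep : G.AvoidReaches u b a := .single ⟨hba, hb, Ne.symm hu.1⟩
        rcases ih with ih | ⟨-, t0, t', ht0, ht', hlink⟩
        · obtain ⟨t', ht', hlink⟩ := ih b .refl
          exact ⟨b, t', hstep, ht', hlink⟩
        · exact ⟨t0, t', ht0.trans hstep, ht', hlink⟩

theorem avoidReaches_or_reaches {s d u : V} (hsd : G.Reaches s d) :
    G.AvoidReaches u s d ∨ G.Reaches u d := by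
  induction hsd with
  | refl => exact Or.inl .refl
  | @tail b c _ hbc ih =>
    rcases ih with ih | ih
    · by_cases hb : b = u
      · exact Or.inr (hb ▸ .single hbc)
      · by_cases hc : c = u
        · exact Or.inr (hc ▸ .refl)
        · exact Or.inl (ih.tail ⟨hbc, hb, hc⟩)
    · exact Or.inr (ih.tail hbc)

theorem exists_linked_keys {s d u : V} (hsd : G.Reaches s d) (hus : u ≠ s) (hud : u ≠ d)
    (hprot : G.IsCutVertex s d u → G.IsProtected s d u) :
    ∃ t t', G.AvoidReaches u t s ∧ G.AvoidReaches u t' d ∧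
      (t = t' ∨ G.Reaches u d ∧ Relation.ReflTransGen (G.Linked u) t t') := by
  by_cases hav : G.AvoidReaches u s d
  · exact ⟨s, s, .refl, hav, Or.inl rfl⟩
  · obtain ⟨p, hp, hcol⟩ := hprot ⟨hus, hud, hav⟩
    have hr := (avoidReaches_or_reaches hsd).resolve_left hav
    rcases exists_linked_of_altPath p hp hcol with h | ⟨-, t, t', ht, ht', hl⟩
    · obtain ⟨t', ht', hl⟩ := h s .refl
      exact ⟨s, t', .refl, ht', Or.inr ⟨hr, hl⟩⟩
    · exact ⟨t, t', ht, ht', Or.inr ⟨hr, hl⟩⟩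

end Linking

/-! ### The secret-sharing code -/

section SecretSharing

variable {V : Type*}

/-- The key generated at the vertex `v` for protection against the vertex `u`: a bit of `v` whose
index encodes `u` and is different from `0`. -/
def key (idx : V → ℕ) (u v : V) (ω : Bits V) : Bool := ω v (idx u + 1)

/-- The first bit of `s`, encrypted with one key for each vertex `u` in `U`, namely the one
generated at `t u`. -/
def cipher (idx : V → ℕ) (U : Finset V) (t : V → V) (s : V) (ω : Bits V) : ZMod 2 :=
  (ω s 0).toNat + ∑ u ∈ U, ((key idx u (t u) ω).toNat : ZMod 2)

open Classical in
/-- What the edge `e` carries in the secret-sharing code, where what is not carried is replaced by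
zero: the keys against `u` which reach `e` along paths avoiding `u`, provided that `e` does not
enter `u` either; the sums of two keys against `u` known at an in-node of `u`, first on the edge
into `u` and then on all edges reached from `u`; the ciphertext, on all edges reached from `s`. -/
noncomputable def sharingMessage (G : AcyclicNetwork V) (idx : V → ℕ) (U : Finset V) (t : V → V)
    (s : V) (e : G.Edge) (ω : Bits V) : (V → V → Bool) × (V → V → V → Bool) × ZMod 2 :=
  (fun u v => if G.AvoidReaches u v e.1.1 ∧ e.1.1 ≠ u ∧ e.1.2 ≠ u then key idx u v ω else false,
    fun u v v' => if G.Linked u v v' ∧ G.Reaches u e.1.1 ∨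
        e.1.2 = u ∧ G.AvoidReaches u v e.1.1 ∧ G.AvoidReaches u v' e.1.1
      then xor (key idx u v ω) (key idx u v' ω) else false,
    if G.Reaches s e.1.1 then cipher idx U t s ω else 0)

variable {G : AcyclicNetwork V} {idx : V → ℕ} {U : Finset V} {t : V → V} {s : V} {N : ℕ}

/-- Two outcomes look the same at the vertex `a`: the messages entering `a` agree, and so do the
first `N` bits of `a`. -/
def SameView (G : AcyclicNetwork V) (idx : V → ℕ) (U : Finset V) (t : V → V) (s : V) (N : ℕ)
    (a : V) (ω ω' : Bits V) : Prop :=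
  (∀ e : G.Edge, e.1.2 = a →
    sharingMessage G idx U t s e ω = sharingMessage G idx U t s e ω') ∧
  ∀ j < N, ω a j = ω' a j

theorem SameView.key_eq {a : V} {ω ω' : Bits V} (hN : ∀ u, idx u + 1 < N)
    (h : SameView G idx U t s N a ω ω') {u v : V} (hv : G.AvoidReaches u v a) :
    key idx u v ω = key idx u v ω' := by
  cases hv with
  | refl => exact h.2 _ (hN u)
  | @tail w _ hvw hwa =>
    have := congrFun (congrFun (congrArg Prod.fst (h.1 ⟨(w, a), hwa.1⟩ rfl)) u) v
    have hc : G.AvoidReaches u v w := hvw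
    simpa only [sharingMessage, hc, hwa.2.1, hwa.2.2, ne_eq, not_false_eq_true, and_self,
      if_true] using this

theorem SameView.xor_key_eq {a : V} {ω ω' : Bits V}
    (h : SameView G idx U t s N a ω ω') {u v v' : V} (hl : G.Linked u v v')
    (hr : G.Reaches u a) :
    xor (key idx u v ω) (key idx u v' ω) = xor (key idx u v ω') (key idx u v' ω') := by
  have hedge (w : V) (hwa : G.Adj w a) := congrFun (congrFun (congrFun
    (congrArg (fun x => x.2.1) (h.1 ⟨(w, a), hwa⟩ rfl)) u) v) v'
  cases hr with
  | refl =>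
    obtain ⟨w, hw, h1, h2⟩ := hl
    simpa only [sharingMessage, h1, h2, and_self, or_true, if_true] using hedge w hw
  | @tail w _ huw hwa =>
    have hc : G.Reaches u w := huw
    simpa only [sharingMessage, hl, hc, and_self, true_or, if_true] using hedge w hwa

theorem SameView.cipher_eq {a : V} {ω ω' : Bits V} (hN : ∀ u, idx u + 1 < N)
    (h : SameView G idx U t s N a ω ω') (ht : ∀ u ∈ U, G.AvoidReaches u (t u) s)
    (hr : G.Reaches s a) : cipher idx U t s ω = cipher idx U t s ω' := by
  cases hr with
  | refl =>
    have h0 : ω s 0 = ω' s 0 := h.2 0 ((Nat.zero_le _).trans_lt (hN s))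
    rw [cipher, cipher, h0, Finset.sum_congr rfl fun u hu => by rw [h.key_eq hN (ht u hu)]]
  | @tail w _ hsw hwa =>
    have := congrArg (fun x => x.2.2) (h.1 ⟨(w, a), hwa⟩ rfl)
    have hc : G.Reaches s w := hsw
    simpa only [sharingMessage, hc, if_true] using this

theorem SameView.sharingMessage_eq {e : G.Edge} {ω ω' : Bits V} (hN : ∀ u, idx u + 1 < N)
    (ht : ∀ u ∈ U, G.AvoidReaches u (t u) s) (h : SameView G idx U t s N e.1.1 ω ω') :
    sharingMessage G idx U t s e ω = sharingMessage G idx U t s e ω' := by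
  classical
  refine Prod.ext ?_ (Prod.ext ?_ ?_)
  · funext u v
    exact ite_congr rfl (fun hc => h.key_eq hN hc.1) fun _ => rfl
  · funext u v v'
    refine ite_congr rfl (fun hc => ?_) fun _ => rfl
    rcases hc with ⟨hl, hr⟩ | ⟨-, h1, h2⟩
    · exact h.xor_key_eq hl hr
    · rw [h.key_eq hN h1, h.key_eq hN h2]
  · exact ite_congr rfl (fun hc => h.cipher_eq hN ht hc) fun _ => rfl

/-- The terminal knows the last key of each chain of linked keys, hence its first key, and
therefore it can decrypt the ciphertext. -/
theorem SameView.source_bit_eq {d : V} {t' : V → V} {ω ω' : Bits V} (hN : ∀ u, idx u + 1 < N)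
    (ht : ∀ u ∈ U, G.AvoidReaches u (t u) s) (ht' : ∀ u ∈ U, G.AvoidReaches u (t' u) d)
    (hlink : ∀ u ∈ U, t u = t' u ∨
      G.Reaches u d ∧ Relation.ReflTransGen (G.Linked u) (t u) (t' u))
    (hsd : G.Reaches s d) (h : SameView G idx U t s N d ω ω') : ω s 0 = ω' s 0 := by
  have hkey (u : V) (hu : u ∈ U) : key idx u (t u) ω = key idx u (t u) ω' := by
    have hlast := h.key_eq hN (ht' u hu)
    rcases hlink u hu with heq | ⟨hr, hchain⟩
    · rwa [heq]
    · generalize t u = a at hchain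
      induction hchain using Relation.ReflTransGen.head_induction_on with
      | refl => exact hlast
      | head hl _ ih =>
        have := h.xor_key_eq hl hr
        rw [ih] at this
        simpa using this
  have hM := h.cipher_eq hN ht hsd
  rw [cipher, cipher, Finset.sum_congr rfl fun u hu => by rw [hkey u hu], add_left_inj] at hM
  revert hM
  generalize ω s 0 = x, ω' s 0 = y
  revert x y
  decide

open Classical in
/-- Flipping the source bit together with all keys against `u` does not change what `u` receives:
`u` sees sums of two keys against itself and a ciphertext in which exactly one such key occurs. -/
theorem sharingMessage_flipBits (hidx : idx.Injective) {u : V} (hu : u ∈ U) {e : G.Edge}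
    (he : e.1.2 = u) (ω : Bits V) :
    sharingMessage G idx U t s e
        (flipBits (fun v j => decide (v = s ∧ j = 0 ∨ j = idx u + 1)) ω) =
      sharingMessage G idx U t s e ω := by
  set ω' := flipBits (fun v j => decide (v = s ∧ j = 0 ∨ j = idx u + 1)) ω with hω'
  have hkey (w v : V) : key idx w v ω' = xor (decide (w = u)) (key idx w v ω) := by
    simp [key, hω', flipBits, hidx.eq_iff]
  have hs : ω' s 0 = !ω s 0 := by simp [hω', flipBits]
  have hnot (b : Bool) : ((!b).toNat : ZMod 2) = b.toNat + 1 := by revert b; decide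
  refine Prod.ext ?_ (Prod.ext ?_ ?_)
  · funext w v
    refine ite_congr rfl (fun hc => ?_) fun _ => rfl
    have hwu : w ≠ u := fun h => hc.2.2 (he.trans h.symm)
    simp [hkey, hwu]
  · funext w v v'
    refine ite_congr rfl (fun _ => ?_) fun _ => rfl
    rw [hkey, hkey]
    generalize decide (w = u) = x, key idx w v ω = y, key idx w v' ω = z
    revert x y z
    decide
  · refine ite_congr rfl (fun _ => ?_) fun _ => rfl
    have hsum : ∑ w ∈ U, ((key idx w (t w) ω').toNat : ZMod 2) =
        ∑ w ∈ U, ((key idx w (t w) ω).toNat : ZMod 2) + 1 := by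
      have hterm (w : V) : ((key idx w (t w) ω').toNat : ZMod 2) =
          (key idx w (t w) ω).toNat + if w = u then 1 else 0 := by
        by_cases hw : w = u
        · simp [hkey, hw, hnot]
        · simp [hkey, hw]
      simp_rw [hterm, Finset.sum_add_distrib, Finset.sum_ite_eq', if_pos hu]
    rw [cipher, cipher, hsum, hs, hnot, add_add_add_comm, CharTwo.add_self_eq_zero, add_zero]

end SecretSharing

theorem exists_rate_of_isProtected {V : Type*} [Finite V] {G : AcyclicNetwork V} {s d : V}
    (hsd : G.Reaches s d) (hprot : ∀ u : V, G.IsCutVertex s d u → G.IsProtected s d u) :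
    ∃ R : ℝ, 0 < R ∧ G.HasSecureMulticastRate s d R := by
  classical
  have := Fintype.ofFinite V
  obtain ⟨n, ⟨φ⟩⟩ := Finite.exists_equiv_fin V
  let idx : V → ℕ := fun v => φ v
  have hidx : idx.Injective := fun v w h => φ.injective (Fin.ext h)
  have hN (u : V) : idx u + 1 < n + 1 := by have := (φ u).2; simp only [idx]; omega
  let U : Finset V := {u | u ≠ s ∧ u ≠ d}
  have hlinked (u : V) (hu : u ∈ U) := exists_linked_keys hsd (Finset.mem_filter.1 hu).2.1
    (Finset.mem_filter.1 hu).2.2 (hprot u)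
  have : Nonempty V := ⟨s⟩
  choose! t t' ht ht' hlink using hlinked
  obtain ⟨c, hc⟩ := G.exists_networkCode (n + 1) (sharingMessage G idx U t s)
    fun e ω ω' h h' => SameView.sharingMessage_eq hN ht ⟨h, h'⟩
  refine ⟨1, one_pos, c, {0}, by norm_num, ?_, fun u hus hud => ?_⟩
  · obtain ⟨decode, hdecode, hmeas⟩ := exists_measurable_factor d (n + 1)
      (sourceMessage s {0}) (c.inMessages d) fun ω ω' h h' => by
        have hview : SameView G idx U t s (n + 1) d ω ω' :=
          ⟨fun e he => (hc e ω ω').1 (congrFun h ⟨e, he⟩), h'⟩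
        have hbit := hview.source_bit_eq hN ht ht' hlink hsd
        funext ⟨j, hj⟩
        obtain rfl := Finset.mem_singleton.1 hj
        exact hbit
    exact ⟨decode, fun x S _ => hmeas x S, Filter.Eventually.of_forall hdecode⟩
  · have hu : u ∈ U := by simp [U, hus, hud]
    rw [mutualInfo_eq_zero_iff_indepFun (measurable_sourceMessage _ _)
      (c.measurable_inMessages u)]
    have hind := indepFun_of_flipBits (s := s) (j := 0) (c.measurable_inMessages u)
      (F := fun v j => decide (v = s ∧ j = 0 ∨ j = idx u + 1)) (by simp) fun ω =>
        funext fun e => (hc e.1 _ _).2 (sharingMessage_flipBits hidx hu e.2 ω)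
    have hK : sourceMessage s {0} =
        (fun (b : Bool) (_ : ({0} : Finset ℕ)) => b) ∘ fun ω : Bits V => ω s 0 := by
      funext ω ⟨j, hj⟩
      obtain rfl := Finset.mem_singleton.1 hj
      rfl
    rw [hK]
    exact hind.comp (measurable_of_finite _) measurable_id

/-! ### Vertices reached by open alternating paths -/

section OpenPaths

variable {V : Type*} {G : AcyclicNetwork V}

/-- Some alternating path between `v` and `s` avoids `u` and has all its colliders among the
in-nodes of `u`. -/
def OpenTo (G : AcyclicNetwork V) (s u v : V) : Prop :=
  ∃ p : G.AltPath v s, u ∉ p.support ∧ ∀ w, G.IsCollider p w → w ∈ G.InNodes u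

/-- As `OpenTo`, but moreover the edge of the path at `v`, if there is one, leaves `v`, so that the
path may be extended by an edge entering `v`. -/
def OpenToByExit (G : AcyclicNetwork V) (s u v : V) : Prop :=
  ∃ p : G.AltPath v s, (u ∉ p.support ∧ ∀ w, G.IsCollider p w → w ∈ G.InNodes u) ∧
    ∀ y, [v, y] <+: p.support → ¬ G.Adj y v

theorem isCollider_reverse {a b v : V} (p : G.AltPath a b) :
    G.IsCollider p.reverse v ↔ G.IsCollider p v := by
  have h (x y : V) : [x, v, y] <:+: p.reverse.support ↔ [y, v, x] <:+: p.support := by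
    rw [SimpleGraph.Walk.support_reverse, ← List.reverse_infix]
    simp
  simp only [IsCollider, h]
  constructor <;> exact fun ⟨x, y, h1, h2, h3⟩ => ⟨y, x, h1, h3, h2⟩

theorem OpenTo.isProtected {s u d : V} (h : G.OpenTo s u d) : G.IsProtected s d u := by
  obtain ⟨p, hp, hcol⟩ := h
  exact ⟨p.reverse, by simpa using hp, fun v hv => hcol v ((isCollider_reverse p).1 hv)⟩

theorem OpenToByExit.openTo {s u v : V} (h : G.OpenToByExit s u v) : G.OpenTo s u v :=
  let ⟨p, hp, _⟩ := h
  ⟨p, hp⟩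

theorem openToByExit_self {s u : V} (h : u ≠ s) : G.OpenToByExit s u s := by
  refine ⟨.nil, ⟨by simpa using h, ?_⟩, ?_⟩
  · rintro w ⟨x, y, hxy, -⟩
    simpa using hxy.length_le
  · intro y hy
    simpa using hy.length_le

theorem OpenTo.forward {s u v w : V} (h : G.OpenTo s u v) (hvw : G.Adj v w) (hw : w ≠ u) :
    G.OpenTo s u w := by
  obtain ⟨p, hp, hcol⟩ := h
  refine ⟨.cons (altAdj_iff.2 (Or.inr hvw)) p, ?_, fun x hx => ?_⟩
  · simp [hw.symm, hp]
  · rcases (isCollider_cons _ _).1 hx with hx | ⟨-, hwv, -⟩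
    · exact hcol x hx
    · exact absurd hwv (not_adj_symm hvw)

theorem openToByExit_cons {s u v w : V} (p : G.AltPath v s)
    (hp : u ∉ p.support ∧ ∀ x, G.IsCollider p x → x ∈ G.InNodes u)
    (hv : (∀ y, [v, y] <+: p.support → ¬ G.Adj y v) ∨ v ∈ G.InNodes u) (hwv : G.Adj w v)
    (hw : w ≠ u) : G.OpenToByExit s u w := by
  refine ⟨.cons (altAdj_iff.2 (Or.inl hwv)) p, ⟨?_, fun x hx => ?_⟩, fun y hy => ?_⟩
  · simp [hw.symm, hp.1]
  · rcases (isCollider_cons _ _).1 hx with hx | ⟨rfl, -, y, hy, hyv⟩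
    · exact hp.2 x hx
    · exact hv.resolve_left fun h => h y hy hyv
  · obtain ⟨l, hl⟩ := support_eq_cons p
    simp only [SimpleGraph.Walk.support_cons, hl, List.cons_prefix_cons, true_and] at hy
    rw [hy.1]
    exact not_adj_symm hwv

/-- The vertices whose bits are tied to those of `s` once `u` has seen its incoming messages: those
reached by open alternating paths whose last edge is traversed backwards, and the in-nodes of `u`
reached by any open alternating path. -/
def tied (G : AcyclicNetwork V) (s u : V) : Set V :=
  {v | G.OpenToByExit s u v ∨ G.OpenTo s u v ∧ v ∈ G.InNodes u}

theorem openTo_of_mem_tied {s u v : V} (h : v ∈ G.tied s u) : G.OpenTo s u v :=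
  h.elim OpenToByExit.openTo And.left

theorem mem_tied_of_adj {s u v w : V} (h : v ∈ G.tied s u) (hwv : G.Adj w v) (hw : w ≠ u) :
    w ∈ G.tied s u := by
  rcases h with ⟨p, hp, hexit⟩ | ⟨⟨p, hp⟩, hv⟩
  · exact Or.inl (openToByExit_cons p hp (Or.inl hexit) hwv hw)
  · exact Or.inl (openToByExit_cons p hp (Or.inr hv) hwv hw)

end OpenPaths

/-! ### Dependence of messages on the random bits -/

section Dependence

variable {V : Type*} [Finite V] {G : AcyclicNetwork V} (c : G.NetworkCode)

/-- The messages on edges upstream of `u` whose tails lie in a set `T` closed under predecessors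
depend only on the bits of `T`. -/
theorem message_congr_of_transGen {T : Set V} {u : V}
    (hT : ∀ x a, G.Adj x a → a ∈ T → a ≠ u → x ≠ u → x ∈ T) {ω ω' : Bits V}
    (hω : ∀ v ∈ T, ω v = ω' v) (e : G.Edge) (he : e.1.1 ∈ T)
    (heu : Relation.TransGen G.Adj e.1.1 u) : c.message ω e = c.message ω' e := by
  have hne {a : V} (ha : Relation.TransGen G.Adj a u) : a ≠ u := fun h =>
    G.acyclic u (by rwa [h] at ha)
  induction e using G.wellFounded_edgePrec.induction with
  | _ e ih =>
  rw [c.message_eq, c.message_eq, hω _ he]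
  congr 1
  funext ⟨e', he'⟩
  have hadj : G.Adj e'.1.1 e.1.1 := he' ▸ e'.2
  have hu' : Relation.TransGen G.Adj e'.1.1 u := heu.head hadj
  exact ih e' he' (hT _ _ hadj he (hne heu) (hne hu')) hu'

/-- If only `u` has edges from a set `A` to its complement, then the messages on edges with tails
outside `A` depend only on what `u` receives and the bits generated outside `A`. -/
theorem message_congr_of_inMessages {A : Set V} {u : V}
    (hA : ∀ x a, G.Adj x a → x ∈ A → a ≠ u → a ∈ A) {ω ω' : Bits V}
    (hω : ∀ v ∉ A, ω v = ω' v) (hZ : c.inMessages u ω = c.inMessages u ω') (e : G.Edge)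
    (he : e.1.1 ∉ A) : c.message ω e = c.message ω' e := by
  induction e using G.wellFounded_edgePrec.induction with
  | _ e ih =>
  rw [c.message_eq, c.message_eq, hω _ he]
  congr 1
  by_cases heu : e.1.1 = u
  · rw [heu, hZ]
  · funext ⟨e', he'⟩
    have hadj : G.Adj e'.1.1 e.1.1 := he' ▸ e'.2
    exact ih e' he' fun h => he (hA _ _ hadj h heu)

end Dependence

theorem isProtected_of_hasSecureMulticastRate {V : Type*} [Finite V] {G : AcyclicNetwork V}
    {s d u : V} {R : ℝ} (hR : 0 < R)
    (hrate : G.HasSecureMulticastRate s d R) (hus : u ≠ s) (hud : u ≠ d) :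
    G.IsProtected s d u := by
  by_contra hprot
  obtain ⟨c, J, hJ, ⟨decode, -, hdecode⟩, hsec⟩ := hrate
  let A : Set V := {v | G.OpenTo s u v}
  let T : Set V := G.tied s u
  let m : Bits V × Bits V → Bits V := mixBits T
  have hTA : T ⊆ A := fun v hv => openTo_of_mem_tied hv
  have hA (x a : V) (h : G.Adj x a) (hx : x ∈ A) (ha : a ≠ u) : a ∈ A :=
    OpenTo.forward hx h ha
  have hdA : d ∉ A := fun h => hprot (OpenTo.isProtected h)
  have hm1 (p) (v : V) (hv : v ∈ T) : m p v = p.1 v := if_pos hv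
  have hm2 (p) (v : V) (hv : v ∉ A) : m p v = p.2 v := if_neg fun h => hv (hTA h)
  -- If two outcomes show the same to `u`, then so does their mixture: every message entering `u`
  -- depends either on the bits of `T` only or on the bits of the complement of `A` only.
  have hZ (p : Bits V × Bits V) (h : c.inMessages u p.1 = c.inMessages u p.2) :
      c.inMessages u (m p) = c.inMessages u p.2 := by
    funext ⟨e, he⟩
    have hadj : G.Adj e.1.1 u := he ▸ e.2
    by_cases hx : e.1.1 ∈ A
    · refine Eq.trans ?_ (congrFun h ⟨e, he⟩)
      exact message_congr_of_transGen c (T := T) (fun x a hxa ha _ hx => mem_tied_of_adj ha hxa hx)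
        (hm1 p) e (Or.inr ⟨hx, hadj⟩) (.single hadj)
    · exact message_congr_of_transGen c (T := Aᶜ) (fun x a hxa ha hau _ hx => ha (hA x a hxa hx hau))
        (hm2 p) e hx (.single hadj)
  have hD (p : Bits V × Bits V) (h : c.inMessages u p.1 = c.inMessages u p.2) :
      decode (c.inMessages d (m p)) (m p d) = decode (c.inMessages d p.2) (p.2 d) := by
    have : c.inMessages d (m p) = c.inMessages d p.2 := by
      funext ⟨e, he⟩
      have hadj : G.Adj e.1.1 d := he ▸ e.2
      exact message_congr_of_inMessages c hA (hm2 p) (hZ p h) e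
        fun hx => hdA (hA _ _ hadj hx hud.symm)
    rw [this, hm2 p d hdA]
  have hK (p : Bits V × Bits V) : sourceMessage s J (m p) = sourceMessage s J p.1 := by
    funext j
    simp only [sourceMessage, hm1 p s (Or.inl (openToByExit_self hus))]
  have hJne : J.Nonempty := by
    rw [Finset.nonempty_iff_ne_empty]
    rintro rfl
    have h1 : 1 < ⌈(2 : ℝ) ^ R⌉₊ :=
      Nat.lt_ceil.2 (by simpa using Real.one_lt_rpow one_lt_two hR)
    simp at hJ
    omega
  obtain ⟨z, hz⟩ : ∃ z, bitsLaw V (c.inMessages u ⁻¹' {z}) ≠ 0 := by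
    by_contra! h
    have h1 : bitsLaw V (⋃ z, c.inMessages u ⁻¹' {z}) = 0 := measure_iUnion_null h
    have h2 : (⋃ z, c.inMessages u ⁻¹' {z}) = Set.univ := by ext; simp
    simp [h2] at h1
  let E (b : Bool) : Set (Bits V) :=
    sourceMessage s J ⁻¹' {fun _ => b} ∩ c.inMessages u ⁻¹' {z}
  have hE (b : Bool) : bitsLaw V (E b) ≠ 0 := by
    have hind := (mutualInfo_eq_zero_iff_indepFun (measurable_sourceMessage s J)
      (c.measurable_inMessages u)).1 (hsec u hus hud)
    rw [ProbabilityTheory.indepFun_iff_measure_inter_preimage_eq_mul.1 hind _ _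
      (measurableSet_singleton _) (measurableSet_singleton _)]
    exact mul_ne_zero (measure_sourceMessage_pos s J _).ne' hz
  have hae : ∀ᵐ p ∂(bitsLaw V).prod (bitsLaw V),
      decode (c.inMessages d (m p)) (m p d) = sourceMessage s J (m p) ∧
        decode (c.inMessages d p.2) (p.2 d) = sourceMessage s J p.2 :=
    ((measurePreserving_mixBits T).quasiMeasurePreserving.ae hdecode).and
      (Measure.quasiMeasurePreserving_snd.ae hdecode)
  obtain ⟨p, ⟨hp1, hp2⟩, hpm, hp⟩ : ∃ p ∈ E true ×ˢ E false,
      decode (c.inMessages d (m p)) (m p d) = sourceMessage s J (m p) ∧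
        decode (c.inMessages d p.2) (p.2 d) = sourceMessage s J p.2 := by
    by_contra! h
    have h0 : (bitsLaw V).prod (bitsLaw V) (E true ×ˢ E false) = 0 := by
      refine measure_mono_null ?_ (ae_iff.1 hae)
      exact fun p hp hp' => h p hp hp'.1 hp'.2
    rw [Measure.prod_prod] at h0
    exact mul_ne_zero (hE true) (hE false) h0
  have hsame : c.inMessages u p.1 = c.inMessages u p.2 := hp1.2.trans hp2.2.symm
  have heq : (fun _ : J => true) = fun _ => false :=
    calc (fun _ : J => true) = sourceMessage s J p.1 := hp1.1.symm
      _ = sourceMessage s J (m p) := (hK p).symm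
      _ = decode (c.inMessages d p.2) (p.2 d) := hpm.symm.trans (hD p hsame)
      _ = fun _ => false := hp.trans hp2.1
  obtain ⟨j, hj⟩ := hJne
  exact absurd (congrFun heq ⟨j, hj⟩) (by decide)

end AcyclicNetwork

/-- In a finite acyclic network in which every vertex generates random bits, with a terminal `d`
that has no outgoing edge and is reachable from the source `s`, a positive secure-multicast rate
from `s` to `d` is achievable if and only if every cut vertex separating `s` from `d` is
protected. -/
theorem theorem1 {V : Type*} [Finite V] (G : AcyclicNetwork V) (s d : V)
    (hd : ∀ v : V, ¬ G.Adj d v) (hsd : G.Reaches s d) :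
    (∃ R : ℝ, 0 < R ∧ G.HasSecureMulticastRate s d R) ↔
      ∀ u : V, G.IsCutVertex s d u → G.IsProtected s d u :=
  ⟨fun ⟨_, hR, hrate⟩ _ hu =>
    AcyclicNetwork.isProtected_of_hasSecureMulticastRate hR hrate hu.1 hu.2.1,
    AcyclicNetwork.exists_rate_of_isProtected hsd⟩
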